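/- Consider control systems with two kinds of inputs $\dot x=Ax+B^uu+B^vv$, $y=Cx+D^uu$, written $(A,B^u,B^v,C,D^u)$, with real matrices, $x\in\mathbb R^n$, $u\in\mathbb R^m$, $v\in\mathbb R^s$, $y\in\mathbb R^p$. An extended Morse transformation is an 8-tuple $(T_x,T_u,T_v,T_y,F_u,F_v,R,K)$ with $T_x\in Gl(n,\mathbb R)$, $T_u\in Gl(m,\mathbb R)$, $T_v\in Gl(s,\mathbb R)$, $T_y\in Gl(p,\mathbb R)$, $F_u\in\mathbb R^{m\times n}$, $F_v\in\mathbb R^{s\times n}$, $R\in\mathbb R^{s\times m}$, $K\in\mathbb R^{n\times p}$; it brings $(A,B^u,B^v,C,D^u)$ into $(\bar A,\bar B^u,\bar B^v,\bar C,\bar D^u)$ if $$\begin{bmatrix}\bar A&\bar B^u&\bar B^v\\ \bar C&\bar D^u&0\end{bmatrix}=\begin{bmatrix}T_x&T_xK\\0&T_y\end{bmatrix}\begin{bmatrix}A&B^u&B^v\\ C&D^u&0\end{bmatrix}\begin{bmatrix}T_x^{-1}&0&0\\F_uT_x^{-1}&T_u^{-1}&0\\(F_v+RF_u)T_x^{-1}&RT_u^{-1}&T_v^{-1}\end{bmatrix}.$$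 A 4-tuple $(A,B,C,D)$, i.e. the system $\dot x=Ax+Bw$, $y=Cx+Dw$, is called prime if there are $T_x,T_w,T_y$ invertible and $F,K$ such that $$\begin{bmatrix}T_x&T_xK\\0&T_y\end{bmatrix}\begin{bmatrix}A&B\\ C&D\end{bmatrix}\begin{bmatrix}T_x^{-1}&0\\FT_x^{-1}&T_w^{-1}\end{bmatrix}$$ is, up to the numbering of coordinates, the system matrix of finitely many independent chains of integrators $\dot x_i^1=x_i^2,\dots,\dot x_i^{\sigma_i}=w_i$, $y_i=x_i^1$, with $\sigma_i\ge 0$, where a chain with $\sigma_i=0$ is the static relation $y_i=w_i$. Let $n=n_1+n_2+n_3+n_4$, $m=m_1+m_3$, $s=s_1+s_3$, $p=p_3+p_4$ (blocks may be of size zero). The system $(\tilde A,\tilde B^{u},\tilde B^{v},\tilde C,\tilde D^{u})$ is in the extended Morse triangular form (EMTF) with these block sizes if $$\left[\begin{array}{c|c|c}\tilde A&\tilde B^{u}&\tilde B^{v}\\ \hline \tilde C&\tilde D^{u}&0\end{array}\right]=\left[\begin{array}{cccc|cc|cc} \tilde A_1&\tilde A_{12}&\tilde A_{13}&\tilde A_{14}&\tilde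 B^u_1&\tilde B^u_{12}&\tilde B^v_1&\tilde B^v_{12}\\ 0&\tilde A_2&0&\tilde A_{24}&0&0&0&0\\ 0&0&\tilde A_3&\tilde A_{34}&0&\tilde B^u_3&0&\tilde B^v_3\\ 0&0&0&\tilde A_4&0&0&0&0\\ \hline 0&0&\tilde C_3&\tilde C_{34}&0&\tilde D^u_3&0&0\\ 0&0&0&\tilde C_4&0&0&0&0\end{array}\right]$$ where the pair $(\tilde A_1,[\tilde B^u_1,\tilde B^v_1])$ is controllable, the pair $(\tilde C_4,\tilde A_4)$ is observable and the 4-tuple $(\tilde A_3,[\tilde B^u_3,\tilde B^v_3],\tilde C_3,[\tilde D^u_3,0])$ is prime. Theorem (extended Morse normal form, EMNF). For every system in the EMTF there exists an extended Morse transformation bringing it into a system $(\bar A,\bar B^{u},\bar B^{v},\bar C,\bar D^{u})$ of the form (with the same block sizes) $$\left[\begin{array}{c|c|c}\bar A&\bar B^{u}&\bar B^{v}\\ \hline \bar C&\bar D^{u}&0\end{array}\right]=\left[\begin{array}{cccc|cc|cc} \bar A_1&0&0&0&\bar B^u_1&0&\bar B^v_1&0\\ 0&\bar A_2&0&0&0&0&0&0\\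 0&0&\bar A_3&0&0&\bar B^u_3&0&\bar B^v_3\\ 0&0&0&\bar A_4&0&0&0&0\\ \hline 0&0&\bar C_3&0&0&\bar D^u_3&0&0\\ 0&0&0&\bar C_4&0&0&0&0\end{array}\right]$$ where the pair $(\bar A_1,[\bar B^u_1,\bar B^v_1])$ is controllable, the pair $(\bar C_4,\bar A_4)$ is observable and the 4-tuple $(\bar A_3,[\bar B^u_3,\bar B^v_3],\bar C_3,[\bar D^u_3,0])$ is prime. -/

import Mathlib

open Matrix

/-- A classical control system `ẋ = A x + B w`, `y = C x + D w`, with state, input and output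
coordinates indexed by `X`, `W`, `Y`. -/
structure ControlSystem (X W Y : Type) where
  A : Matrix X X ℝ
  B : Matrix X W ℝ
  C : Matrix Y X ℝ
  D : Matrix Y W ℝ

/-- A control system with two kinds of inputs `ẋ = A x + Bᵘ u + Bᵛ v`, `y = C x + Dᵘ u`. -/
structure ODECS (X U V Y : Type) where
  A : Matrix X X ℝ
  Bu : Matrix X U ℝ
  Bv : Matrix X V ℝ
  C : Matrix Y X ℝ
  Du : Matrix Y U ℝ

/-- The matrix `[A B; C D]`. -/
def ControlSystem.systemMatrix {X W Y : Type} (S : ControlSystem X W Y) :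
    Matrix (X ⊕ Y) (X ⊕ W) ℝ :=
  fromBlocks S.A S.B S.C S.D

/-- The matrix `[A Bᵘ Bᵛ; C Dᵘ 0]`. -/
def ODECS.systemMatrix {X U V Y : Type} (L : ODECS X U V Y) :
    Matrix (X ⊕ Y) (X ⊕ (U ⊕ V)) ℝ :=
  fromBlocks L.A (fromCols L.Bu L.Bv) L.C (fromCols L.Du 0)

/-- The pair `(A, B)` is controllable: `Im B + A Im B + ⋯ + A^(n-1) Im B` is the whole
state space. -/
def IsControllable {X W : Type} [Fintype X] [DecidableEq X] [Fintype W]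
    (A : Matrix X X ℝ) (B : Matrix X W ℝ) : Prop :=
  (⨆ k : Fin (Fintype.card X), LinearMap.range (A ^ (k : ℕ) * B).mulVecLin) = ⊤

/-- The pair `(C, A)` is observable: `ker C ∩ ker C A ∩ ⋯ ∩ ker C A^(n-1)` is zero. -/
def IsObservable {X Y : Type} [Fintype X] [DecidableEq X]
    (C : Matrix Y X ℝ) (A : Matrix X X ℝ) : Prop :=
  (⨅ k : Fin (Fintype.card X), LinearMap.ker (C * A ^ (k : ℕ)).mulVecLin) = ⊥

/-- Morse equivalence of classical control systems: coordinate changes in the state, input and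
output spaces, state feedback `F` and output injection `K`. -/
def MorseEquivalent {X W Y : Type} [Fintype X] [DecidableEq X] [Fintype W] [DecidableEq W]
    [Fintype Y] [DecidableEq Y] (S S' : ControlSystem X W Y) : Prop :=
  ∃ (Tx : GL X ℝ) (Tw : GL W ℝ) (Ty : GL Y ℝ) (F : Matrix W X ℝ) (K : Matrix X Y ℝ),
    S'.systemMatrix =
      fromBlocks Tx.val (Tx.val * K) 0 Ty.val * S.systemMatrix *
        fromBlocks (Tx⁻¹).val 0 (F * (Tx⁻¹).val) (Tw⁻¹).val

/-- `k` independent chains of integrators of lengths `σ i`, the `i`-th one being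
`ẋ_{i,0} = x_{i,1}, …, ẋ_{i,σ i - 1} = w_i`, `y_i = x_{i,0}`;
a chain of length zero is the static relation `y_i = w_i`. -/
def integratorChains {k : ℕ} (σ : Fin k → ℕ) :
    ControlSystem (Σ i : Fin k, Fin (σ i)) (Fin k) (Fin k) where
  A := of fun a b => if a.1 = b.1 ∧ (a.2 : ℕ) + 1 = (b.2 : ℕ) then 1 else 0
  B := of fun a j => if a.1 = j ∧ (a.2 : ℕ) + 1 = σ a.1 then 1 else 0
  C := of fun i b => if i = b.1 ∧ (b.2 : ℕ) = 0 then 1 else 0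
  D := of fun i j => if i = j ∧ σ i = 0 then 1 else 0

/-- Renaming of the coordinates. -/
def ControlSystem.reindex {X W Y X' W' Y' : Type} (eX : X ≃ X') (eW : W ≃ W') (eY : Y ≃ Y')
    (S : ControlSystem X W Y) : ControlSystem X' W' Y' where
  A := Matrix.reindex eX eX S.A
  B := Matrix.reindex eX eW S.B
  C := Matrix.reindex eY eX S.C
  D := Matrix.reindex eY eW S.D

/-- A system is prime if it is Morse equivalent to independent chains of integrators (the
bijections only number the coordinates of the chains by the index types of the given system). -/
def ControlSystem.IsPrime {X W Y : Type} [Fintype X] [DecidableEq X] [Fintype W] [DecidableEq W]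
    [Fintype Y] [DecidableEq Y] (S : ControlSystem X W Y) : Prop :=
  ∃ (k : ℕ) (σ : Fin k → ℕ) (eX : (Σ i : Fin k, Fin (σ i)) ≃ X) (eW : Fin k ≃ W)
    (eY : Fin k ≃ Y), MorseEquivalent S ((integratorChains σ).reindex eX eW eY)

/-- An extended Morse transformation `(T_x, T_u, T_v, T_y, F_u, F_v, R, K)`. -/
structure EMTransformation (X U V Y : Type) [Fintype X] [DecidableEq X] [Fintype U]
    [DecidableEq U] [Fintype V] [DecidableEq V] [Fintype Y] [DecidableEq Y] where
  Tx : GL X ℝ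
  Tu : GL U ℝ
  Tv : GL V ℝ
  Ty : GL Y ℝ
  Fu : Matrix U X ℝ
  Fv : Matrix V X ℝ
  R : Matrix V U ℝ
  K : Matrix X Y ℝ

/-- The extended Morse transformation `T` brings the system `L` into the system `L'`. -/
def EMTransformation.Brings {X U V Y : Type} [Fintype X] [DecidableEq X] [Fintype U]
    [DecidableEq U] [Fintype V] [DecidableEq V] [Fintype Y] [DecidableEq Y]
    (T : EMTransformation X U V Y) (L L' : ODECS X U V Y) : Prop :=
  L'.systemMatrix =
    fromBlocks T.Tx.val (T.Tx.val * T.K) 0 T.Ty.val * L.systemMatrix *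
      fromBlocks (T.Tx⁻¹).val 0
        (fromRows (T.Fu * (T.Tx⁻¹).val) ((T.Fv + T.R * T.Fu) * (T.Tx⁻¹).val))
        (fromBlocks (T.Tu⁻¹).val 0 (T.R * (T.Tu⁻¹).val) (T.Tv⁻¹).val)

/-- Sizes of the blocks of the state `x`, the inputs `u`, `v` and the output `y`. -/
structure BlockSizes where
  n₁ : ℕ
  n₂ : ℕ
  n₃ : ℕ
  n₄ : ℕ
  m₁ : ℕ
  m₃ : ℕ
  s₁ : ℕ
  s₃ : ℕ
  p₃ : ℕ
  p₄ : ℕ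

namespace BlockSizes

abbrev n (d : BlockSizes) : ℕ := (d.n₁ + d.n₂) + (d.n₃ + d.n₄)
abbrev m (d : BlockSizes) : ℕ := d.m₁ + d.m₃
abbrev s (d : BlockSizes) : ℕ := d.s₁ + d.s₃
abbrev p (d : BlockSizes) : ℕ := d.p₃ + d.p₄

/-- The partition of the state coordinates into four consecutive blocks. -/
def stateEquiv (d : BlockSizes) :
    (Fin d.n₁ ⊕ Fin d.n₂) ⊕ (Fin d.n₃ ⊕ Fin d.n₄) ≃ Fin d.n :=
  (Equiv.sumCongr finSumFinEquiv finSumFinEquiv).trans finSumFinEquiv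

end BlockSizes

/-- The system with block matrix
```
A₁ A₁₂ A₁₃ A₁₄ | Bu₁ Bu₁₂ | Bv₁ Bv₁₂
0  A₂  0   A₂₄ | 0   0    | 0   0
0  0   A₃  A₃₄ | 0   Bu₃  | 0   Bv₃
0  0   0   A₄  | 0   0    | 0   0
---------------+----------+---------
0  0   C₃  C₃₄ | 0   Du₃  | 0   0
0  0   0   C₄  | 0   0    | 0   0
``` -/
def blockTriangularSystem (d : BlockSizes)
    (A₁ : Matrix (Fin d.n₁) (Fin d.n₁) ℝ) (A₁₂ : Matrix (Fin d.n₁) (Fin d.n₂) ℝ)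
    (A₁₃ : Matrix (Fin d.n₁) (Fin d.n₃) ℝ) (A₁₄ : Matrix (Fin d.n₁) (Fin d.n₄) ℝ)
    (A₂ : Matrix (Fin d.n₂) (Fin d.n₂) ℝ) (A₂₄ : Matrix (Fin d.n₂) (Fin d.n₄) ℝ)
    (A₃ : Matrix (Fin d.n₃) (Fin d.n₃) ℝ) (A₃₄ : Matrix (Fin d.n₃) (Fin d.n₄) ℝ)
    (A₄ : Matrix (Fin d.n₄) (Fin d.n₄) ℝ)
    (Bu₁ : Matrix (Fin d.n₁) (Fin d.m₁) ℝ) (Bu₁₂ : Matrix (Fin d.n₁) (Fin d.m₃) ℝ)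
    (Bu₃ : Matrix (Fin d.n₃) (Fin d.m₃) ℝ)
    (Bv₁ : Matrix (Fin d.n₁) (Fin d.s₁) ℝ) (Bv₁₂ : Matrix (Fin d.n₁) (Fin d.s₃) ℝ)
    (Bv₃ : Matrix (Fin d.n₃) (Fin d.s₃) ℝ)
    (C₃ : Matrix (Fin d.p₃) (Fin d.n₃) ℝ) (C₃₄ : Matrix (Fin d.p₃) (Fin d.n₄) ℝ)
    (C₄ : Matrix (Fin d.p₄) (Fin d.n₄) ℝ)
    (Du₃ : Matrix (Fin d.p₃) (Fin d.m₃) ℝ) :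
    ODECS (Fin d.n) (Fin d.m) (Fin d.s) (Fin d.p) where
  A := reindex d.stateEquiv d.stateEquiv
    (fromBlocks (fromBlocks A₁ A₁₂ 0 A₂) (fromBlocks A₁₃ A₁₄ 0 A₂₄)
      0 (fromBlocks A₃ A₃₄ 0 A₄))
  Bu := reindex d.stateEquiv finSumFinEquiv
    (fromRows (fromBlocks Bu₁ Bu₁₂ 0 0) (fromBlocks 0 Bu₃ 0 0))
  Bv := reindex d.stateEquiv finSumFinEquiv
    (fromRows (fromBlocks Bv₁ Bv₁₂ 0 0) (fromBlocks 0 Bv₃ 0 0))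
  C := reindex finSumFinEquiv d.stateEquiv
    (fromCols 0 (fromBlocks C₃ C₃₄ 0 C₄))
  Du := reindex finSumFinEquiv finSumFinEquiv (fromBlocks 0 Du₃ 0 0)

/-- Conditions on the diagonal subsystems: the first is controllable, the third is prime and the
fourth is observable, where `w = (u, v)`. -/
def DiagonalConditions (d : BlockSizes)
    (A₁ : Matrix (Fin d.n₁) (Fin d.n₁) ℝ)
    (Bu₁ : Matrix (Fin d.n₁) (Fin d.m₁) ℝ) (Bv₁ : Matrix (Fin d.n₁) (Fin d.s₁) ℝ)
    (A₃ : Matrix (Fin d.n₃) (Fin d.n₃) ℝ)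
    (Bu₃ : Matrix (Fin d.n₃) (Fin d.m₃) ℝ) (Bv₃ : Matrix (Fin d.n₃) (Fin d.s₃) ℝ)
    (C₃ : Matrix (Fin d.p₃) (Fin d.n₃) ℝ) (Du₃ : Matrix (Fin d.p₃) (Fin d.m₃) ℝ)
    (A₄ : Matrix (Fin d.n₄) (Fin d.n₄) ℝ) (C₄ : Matrix (Fin d.p₄) (Fin d.n₄) ℝ) : Prop :=
  IsControllable A₁ (fromCols Bu₁ Bv₁) ∧
  IsObservable C₄ A₄ ∧
  (ControlSystem.mk A₃ (fromCols Bu₃ Bv₃) C₃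
    (fromCols Du₃ (0 : Matrix (Fin d.p₃) (Fin d.s₃) ℝ))).IsPrime

/-- The system is in the extended Morse triangular form with block sizes `d`. -/
def IsEMTF (d : BlockSizes) (L : ODECS (Fin d.n) (Fin d.m) (Fin d.s) (Fin d.p)) : Prop :=
  ∃ A₁ A₁₂ A₁₃ A₁₄ A₂ A₂₄ A₃ A₃₄ A₄ Bu₁ Bu₁₂ Bu₃ Bv₁ Bv₁₂ Bv₃ C₃ C₃₄ C₄ Du₃,
    L = blockTriangularSystem d A₁ A₁₂ A₁₃ A₁₄ A₂ A₂₄ A₃ A₃₄ A₄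
          Bu₁ Bu₁₂ Bu₃ Bv₁ Bv₁₂ Bv₃ C₃ C₃₄ C₄ Du₃ ∧
    DiagonalConditions d A₁ Bu₁ Bv₁ A₃ Bu₃ Bv₃ C₃ Du₃ A₄ C₄

/-- The system is in the extended Morse normal form with block sizes `d`: it has the triangular
form with all the coupling blocks `A₁₂, A₁₃, A₁₄, A₂₄, A₃₄, Bu₁₂, Bv₁₂, C₃₄` equal to zero. -/
def IsEMNF (d : BlockSizes) (L : ODECS (Fin d.n) (Fin d.m) (Fin d.s) (Fin d.p)) : Prop :=
  ∃ A₁ A₂ A₃ A₄ Bu₁ Bu₃ Bv₁ Bv₃ C₃ C₄ Du₃,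
    L = blockTriangularSystem d A₁ 0 0 0 A₂ 0 A₃ 0 A₄ Bu₁ 0 Bu₃ Bv₁ 0 Bv₃ C₃ 0 C₄ Du₃ ∧
    DiagonalConditions d A₁ Bu₁ Bv₁ A₃ Bu₃ Bv₃ C₃ Du₃ A₄ C₄

/-! The diagonal blocks stay untouched; a block unitriangular state change, feedback and output
injection remove the couplings. Each coupling then imposes a Sylvester-type linear equation: `A₁₂`
and `A₁₄` use controllability of block 1, `A₂₄` observability of block 4, and block 3, being prime,
serves twice: its full column rank removes `A₁₃` together with the input couplings `Bu₁₂`, `Bv₁₂`,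
its full row rank removes `A₃₄` together with `C₃₄`. Solvability (`FullRowRank.exists_solution` and
its transpose) is the Fredholm alternative: under the trace pairing, an obstruction is a pair `(U,
V)` with `U A + V C = N U`, `U B + V D = 0`. Full row rank is phrased with a matrix `N` precisely to
exclude such pairs, so no eigenvalues or complex scalars are needed. These rank conditions follow
directly from controllability and observability; for prime systems they are checked on integrator
chains and carried over by Morse equivalence. -/

namespace ControlSystem

/-! ### Rank conditions and duality -/

variable {X W Y : Type}

/-- The pencil `[A - λ B; C D]` has full row rank for every `λ`, expressed with a matrix `N` in
place of `λ`. -/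
def FullRowRank [Fintype X] [Fintype Y] (S : ControlSystem X W Y) : Prop :=
  ∀ (r : ℕ) (N : Matrix (Fin r) (Fin r) ℝ) (P : Matrix (Fin r) X ℝ) (Q : Matrix (Fin r) Y ℝ),
    P * S.A + Q * S.C = N * P → P * S.B + Q * S.D = 0 → P = 0 ∧ Q = 0

/-- The pencil `[A - λ B; C D]` has full column rank for every `λ`, expressed with a matrix `N` in
place of `λ`. -/
def FullColRank [Fintype X] [Fintype W] (S : ControlSystem X W Y) : Prop :=
  ∀ (r : ℕ) (N : Matrix (Fin r) (Fin r) ℝ) (P : Matrix X (Fin r) ℝ) (Q : Matrix W (Fin r) ℝ),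
    S.A * P + S.B * Q = P * N → S.C * P + S.D * Q = 0 → P = 0 ∧ Q = 0

/-- The dual system. -/
def dual (S : ControlSystem X W Y) : ControlSystem X Y W where
  A := S.Aᵀ
  B := S.Cᵀ
  C := S.Bᵀ
  D := S.Dᵀ

theorem FullColRank.dual [Fintype X] [Fintype W] {S : ControlSystem X W Y} (h : S.FullColRank) :
    S.dual.FullRowRank := by
  intro r N P Q h₁ h₂
  have := h r Nᵀ Pᵀ Qᵀ
    (by simpa [ControlSystem.dual, transpose_mul] using congrArg transpose h₁)
    (by simpa [ControlSystem.dual, transpose_mul] using congrArg transpose h₂)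
  simpa using this

end ControlSystem

/-! ### Solvability of the regulator equations -/

/-- Every linear functional on matrices is of the form `M ↦ trace (U * M)`. -/
theorem exists_forall_eq_trace_mul {m n : Type} [Fintype m] [Fintype n]
    (f : Matrix m n ℝ →ₗ[ℝ] ℝ) : ∃ U : Matrix n m ℝ, ∀ M, f M = trace (U * M) := by
  classical
  refine ⟨of fun j i => f (single i j 1), fun M => ?_⟩
  conv_lhs => rw [matrix_eq_sum_single M]
  simp only [map_sum, trace, diag_apply, Matrix.mul_apply, of_apply]
  rw [Finset.sum_comm]
  refine Finset.sum_congr rfl fun j _ => Finset.sum_congr rfl fun i _ => ?_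
  have : single i j (M i j) = M i j • single i j (1 : ℝ) := by simp [smul_single]
  rw [this, map_smul, smul_eq_mul, mul_comm]

theorem eq_zero_of_forall_trace_mul {m n : Type} [Fintype m] [Fintype n]
    {U : Matrix n m ℝ} (h : ∀ M : Matrix m n ℝ, trace (U * M) = 0) : U = 0 :=
  ext_iff_trace_mul_right.2 fun M => by simp [h]

/-- If the pencil of the system has full row rank, then the regulator equations
`A X - X N - B F = P`, `C X - D F = Q` are solvable. -/
theorem ControlSystem.FullRowRank.exists_solution {X W Y : Type} [Fintype X] [Fintype W]
    [Fintype Y] {S : ControlSystem X W Y} (h : S.FullRowRank) {r : ℕ}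
    (N : Matrix (Fin r) (Fin r) ℝ) (P : Matrix X (Fin r) ℝ) (Q : Matrix Y (Fin r) ℝ) :
    ∃ (Z : Matrix X (Fin r) ℝ) (F : Matrix W (Fin r) ℝ),
      S.A * Z - Z * N - S.B * F = P ∧ S.C * Z - S.D * F = Q := by
  let Φ : Matrix X (Fin r) ℝ × Matrix W (Fin r) ℝ →ₗ[ℝ]
      Matrix X (Fin r) ℝ × Matrix Y (Fin r) ℝ :=
    { toFun := fun z => (S.A * z.1 - z.1 * N - S.B * z.2, S.C * z.1 - S.D * z.2)
      map_add' := fun z z' => by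
        ext1 <;> simp only [Prod.fst_add, Prod.snd_add, Matrix.mul_add, Matrix.add_mul] <;> abel
      map_smul' := fun c z => by
        ext1 <;> simp [smul_sub] }
  suffices hΦ : LinearMap.range Φ = ⊤ by
    obtain ⟨⟨Z, F⟩, hZ⟩ := LinearMap.range_eq_top.1 hΦ (P, Q)
    exact ⟨Z, F, congrArg Prod.fst hZ, congrArg Prod.snd hZ⟩
  -- A proper range lies in the kernel of a nonzero functional, represented by traces against `U`
  -- and `V`.
  by_contra hne
  obtain ⟨f, hf, hle⟩ := Submodule.exists_le_ker_of_lt_top _ (lt_top_iff_ne_top.2 hne)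
  obtain ⟨U, hU⟩ := exists_forall_eq_trace_mul (f ∘ₗ LinearMap.inl ℝ _ _)
  obtain ⟨V, hV⟩ := exists_forall_eq_trace_mul (f ∘ₗ LinearMap.inr ℝ _ _)
  have hUV : ∀ a b, f (a, b) = trace (U * a) + trace (V * b) := fun a b => by
    rw [← hU, ← hV, LinearMap.comp_apply, LinearMap.comp_apply, ← map_add]
    simp
  have hz : ∀ (Z : Matrix X (Fin r) ℝ) (F : Matrix W (Fin r) ℝ),
      trace (U * (S.A * Z - Z * N - S.B * F)) + trace (V * (S.C * Z - S.D * F)) = 0 :=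
    fun Z F => by
      rw [← hUV]
      exact hle ⟨(Z, F), rfl⟩
  -- Varying `Z` and `F` separately yields exactly the relations that full row rank forbids.
  have h₁ : U * S.A + V * S.C - N * U = 0 := eq_zero_of_forall_trace_mul fun Z => by
    have := hz Z 0
    simp only [Matrix.mul_zero, sub_zero, Matrix.mul_sub, trace_sub] at this
    rw [Matrix.sub_mul, Matrix.add_mul, trace_sub, trace_add, Matrix.mul_assoc, Matrix.mul_assoc,
      Matrix.mul_assoc, trace_mul_comm N, Matrix.mul_assoc]
    linarith
  have h₂ : U * S.B + V * S.D = 0 := eq_zero_of_forall_trace_mul fun F => by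
    have := hz 0 F
    simp only [Matrix.mul_zero, Matrix.zero_mul, zero_sub, Matrix.mul_neg, trace_neg,
      sub_zero] at this
    rw [Matrix.add_mul, trace_add, Matrix.mul_assoc, Matrix.mul_assoc]
    linarith
  obtain ⟨rfl, rfl⟩ := h r N U V (sub_eq_zero.1 h₁) h₂
  exact hf (LinearMap.ext fun z => by simpa using hUV z.1 z.2)

/-- The transposed form of `ControlSystem.FullRowRank.exists_solution`. -/
theorem ControlSystem.FullColRank.exists_solution {X W Y : Type} [Fintype X] [Fintype W]
    [Fintype Y] {S : ControlSystem X W Y} (h : S.FullColRank) {r : ℕ}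
    (N : Matrix (Fin r) (Fin r) ℝ) (P : Matrix (Fin r) X ℝ) (Q : Matrix (Fin r) W ℝ) :
    ∃ (Z : Matrix (Fin r) X ℝ) (K : Matrix (Fin r) Y ℝ),
      N * Z - Z * S.A - K * S.C = P ∧ Z * S.B + K * S.D = Q := by
  obtain ⟨Z, F, h₁, h₂⟩ := h.dual.exists_solution Nᵀ (-Pᵀ) Qᵀ
  refine ⟨Zᵀ, -Fᵀ, ?_, ?_⟩
  · have := congrArg transpose h₁
    simp only [ControlSystem.dual, transpose_sub, transpose_mul, transpose_transpose,
      transpose_neg] at this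
    rw [← neg_eq_iff_eq_neg.2 this, Matrix.neg_mul]
    abel
  · have := congrArg transpose h₂
    simp only [ControlSystem.dual, transpose_sub, transpose_mul, transpose_transpose] at this
    rw [← this, Matrix.neg_mul, sub_eq_add_neg]

/-! ### Controllable and observable pairs -/

theorem pow_mul_comm_of_intertwine {X Z : Type} [Fintype X] [DecidableEq X] [Fintype Z]
    [DecidableEq Z] {A : Matrix X X ℝ} {N : Matrix Z Z ℝ} {P : Matrix Z X ℝ} (h : P * A = N * P)
    (k : ℕ) : P * A ^ k = N ^ k * P := by
  induction k with
  | zero => simp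
  | succ k ih => rw [pow_succ, ← Matrix.mul_assoc, ih, Matrix.mul_assoc, h, pow_succ,
      Matrix.mul_assoc]

/-- A controllable pair, viewed as a system without outputs, has a pencil of full row rank. -/
theorem IsControllable.fullRowRank {X W : Type} [Fintype X] [DecidableEq X] [Fintype W]
    {A : Matrix X X ℝ} {B : Matrix X W ℝ} (h : IsControllable A B) :
    (ControlSystem.mk A B (0 : Matrix (Fin 0) X ℝ) 0).FullRowRank := by
  intro r N P Q h₁ h₂
  refine ⟨?_, Subsingleton.elim _ _⟩
  simp only [Matrix.mul_zero, add_zero] at h₁ h₂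
  -- `P A^k B = N^k P B = 0`, so `P` kills the whole reachable space.
  have hker : (⊤ : Submodule ℝ (X → ℝ)) ≤ LinearMap.ker P.mulVecLin := by
    rw [← show _ = (⊤ : Submodule ℝ (X → ℝ)) from h]
    refine iSup_le fun k => ?_
    rintro _ ⟨w, rfl⟩
    simp only [LinearMap.mem_ker, mulVecLin_apply, mulVec_mulVec]
    rw [← Matrix.mul_assoc, pow_mul_comm_of_intertwine h₁, Matrix.mul_assoc, h₂, Matrix.mul_zero,
      zero_mulVec]
  refine ext_of_mulVec_single fun j => ?_
  rw [zero_mulVec]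
  exact hker Submodule.mem_top

/-- An observable pair, viewed as a system without inputs, has a pencil of full column rank. -/
theorem IsObservable.fullColRank {X Y : Type} [Fintype X] [DecidableEq X] [Fintype Y]
    {A : Matrix X X ℝ} {C : Matrix Y X ℝ} (h : IsObservable C A) :
    (ControlSystem.mk A (0 : Matrix X (Fin 0) ℝ) C 0).FullColRank := by
  intro r N P Q h₁ h₂
  refine ⟨?_, Subsingleton.elim _ _⟩
  simp only [Matrix.zero_mul, add_zero] at h₁ h₂
  refine ext_of_mulVec_single fun j => ?_
  rw [zero_mulVec, ← Submodule.mem_bot ℝ, ← show _ = (⊥ : Submodule ℝ (X → ℝ)) from h]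
  simp only [Submodule.mem_iInf, LinearMap.mem_ker, mulVecLin_apply, mulVec_mulVec]
  intro k
  rw [Matrix.mul_assoc, ← pow_mul_comm_of_intertwine h₁.symm, ← Matrix.mul_assoc, h₂,
    Matrix.zero_mul, zero_mulVec]

/-! ### Invariance under Morse equivalence and renaming -/

namespace ControlSystem

section Morse

variable {X W Y : Type} [Fintype X] [DecidableEq X] [Fintype W] [DecidableEq W]
  [Fintype Y] [DecidableEq Y] {S S' : ControlSystem X W Y}

/-- A test row `[P Q]` is pulled back through the invertible left factor. The feedback has no
effect, because it multiplies the zero input part of `[N P, 0]`. -/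
theorem FullRowRank.of_morseEquivalent (h : S'.FullRowRank) (e : MorseEquivalent S S') :
    S.FullRowRank := by
  obtain ⟨Tx, Tw, Ty, F, K, e⟩ := e
  intro r N P Q h₁ h₂
  have hS : fromCols P Q * S.systemMatrix = fromCols (N * P) 0 := by
    rw [systemMatrix, fromCols_mul_fromBlocks, h₁, h₂]
  have hx : (Tx⁻¹).val * Tx.val = 1 := Tx.inv_mul
  have hy : (Ty⁻¹).val * Ty.val = 1 := Ty.inv_mul
  have hL : fromCols (P * (Tx⁻¹).val) ((Q - P * K) * (Ty⁻¹).val) *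
      fromBlocks Tx.val (Tx.val * K) 0 Ty.val = fromCols P Q := by
    rw [fromCols_mul_fromBlocks, Matrix.mul_zero, add_zero, Matrix.mul_assoc, hx, Matrix.mul_one,
      ← Matrix.mul_assoc, Matrix.mul_assoc P, hx, Matrix.mul_one, Matrix.mul_assoc, hy,
      Matrix.mul_one, add_sub_cancel]
  have hS' : fromCols (P * (Tx⁻¹).val) ((Q - P * K) * (Ty⁻¹).val) * S'.systemMatrix =
      fromCols (N * (P * (Tx⁻¹).val)) 0 := by
    rw [e, ← Matrix.mul_assoc, ← Matrix.mul_assoc, hL, hS, fromCols_mul_fromBlocks]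
    simp [Matrix.mul_assoc]
  rw [systemMatrix, fromCols_mul_fromBlocks, fromCols_ext_iff] at hS'
  obtain ⟨hP, hQ⟩ := h r N _ _ hS'.1 hS'.2
  rw [hP, hQ] at hL
  rw [Matrix.fromCols_zero, Matrix.zero_mul, ← Matrix.fromCols_zero, fromCols_ext_iff] at hL
  exact ⟨hL.1.symm, hL.2.symm⟩

theorem FullColRank.of_morseEquivalent (h : S'.FullColRank) (e : MorseEquivalent S S') :
    S.FullColRank := by
  obtain ⟨Tx, Tw, Ty, F, K, e⟩ := e
  intro r N P Q h₁ h₂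
  have hS : S.systemMatrix * fromRows P Q = fromRows (P * N) 0 := by
    rw [systemMatrix, fromBlocks_mul_fromRows, h₁, h₂]
  have hx : (Tx⁻¹).val * Tx.val = 1 := Tx.inv_mul
  have hw : (Tw⁻¹).val * Tw.val = 1 := Tw.inv_mul
  have hR : fromBlocks (Tx⁻¹).val 0 (F * (Tx⁻¹).val) (Tw⁻¹).val *
      fromRows (Tx.val * P) (Tw.val * (Q - F * P)) = fromRows P Q := by
    rw [fromBlocks_mul_fromRows, Matrix.zero_mul, add_zero, ← Matrix.mul_assoc, hx, Matrix.one_mul,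
      Matrix.mul_assoc, ← Matrix.mul_assoc _ _ P, hx, Matrix.one_mul, ← Matrix.mul_assoc, hw,
      Matrix.one_mul, add_sub_cancel]
  have hS' : S'.systemMatrix * fromRows (Tx.val * P) (Tw.val * (Q - F * P)) =
      fromRows (Tx.val * P * N) 0 := by
    rw [e, Matrix.mul_assoc, hR, Matrix.mul_assoc, hS, fromBlocks_mul_fromRows]
    simp [Matrix.mul_assoc]
  rw [systemMatrix, fromBlocks_mul_fromRows, fromRows_ext_iff] at hS'
  obtain ⟨hP, hQ⟩ := h r N _ _ hS'.1 hS'.2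
  rw [hP, hQ] at hR
  rw [Matrix.fromRows_zero, Matrix.mul_zero, ← Matrix.fromRows_zero, fromRows_ext_iff] at hR
  exact ⟨hR.1.symm, hR.2.symm⟩

end Morse

section Reindex

variable {X W Y X' W' Y' : Type} {S : ControlSystem X W Y}

theorem FullRowRank.reindex [Fintype X] [Fintype Y] [Fintype X'] [Fintype Y']
    (h : S.FullRowRank) (eX : X ≃ X') (eW : W ≃ W') (eY : Y ≃ Y') :
    (S.reindex eX eW eY).FullRowRank := by
  intro r N P Q h₁ h₂
  obtain ⟨P, rfl⟩ : ∃ P' : Matrix (Fin r) X ℝ, P = P'.submatrix id eX.symm :=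
    ⟨P.submatrix id eX, by simp⟩
  obtain ⟨Q, rfl⟩ : ∃ Q' : Matrix (Fin r) Y ℝ, Q = Q'.submatrix id eY.symm :=
    ⟨Q.submatrix id eY, by simp⟩
  have hN : N * P.submatrix id eX.symm = (N * P).submatrix id eX.symm :=
    (submatrix_mul N P id id eX.symm Function.bijective_id).symm
  rw [hN] at h₁
  simp only [ControlSystem.reindex, reindex_apply, submatrix_mul_equiv] at h₁ h₂
  obtain ⟨rfl, rfl⟩ := h r N P Q
    (ext fun z x => by simpa using congrFun₂ h₁ z (eX x))
    (ext fun z w => by simpa using congrFun₂ h₂ z (eW w))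
  exact ⟨rfl, rfl⟩

theorem FullColRank.reindex [Fintype X] [Fintype W] [Fintype X'] [Fintype W']
    (h : S.FullColRank) (eX : X ≃ X') (eW : W ≃ W') (eY : Y ≃ Y') :
    (S.reindex eX eW eY).FullColRank := by
  intro r N P Q h₁ h₂
  obtain ⟨P, rfl⟩ : ∃ P' : Matrix X (Fin r) ℝ, P = P'.submatrix eX.symm id :=
    ⟨P.submatrix eX id, by simp⟩
  obtain ⟨Q, rfl⟩ : ∃ Q' : Matrix W (Fin r) ℝ, Q = Q'.submatrix eW.symm id :=
    ⟨Q.submatrix eW id, by simp⟩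
  have hN : P.submatrix eX.symm id * N = (P * N).submatrix eX.symm id :=
    (submatrix_mul P N eX.symm id id Function.bijective_id).symm
  rw [hN] at h₁
  simp only [ControlSystem.reindex, reindex_apply, submatrix_mul_equiv] at h₁ h₂
  obtain ⟨rfl, rfl⟩ := h r N P Q
    (ext fun x z => by simpa using congrFun₂ h₁ (eX x) z)
    (ext fun y z => by simpa using congrFun₂ h₂ (eY y) z)
  exact ⟨rfl, rfl⟩

end Reindex

end ControlSystem

/-! ### Integrator chains and prime systems -/

section Chains

variable {k : ℕ} {σ : Fin k → ℕ}

/-- The sum over the coordinates of the chains of a function supported at `⟨i, j⟩`. -/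
theorem sum_chain_ite {i : Fin k} (j : Fin (σ i)) {q : (Σ i : Fin k, Fin (σ i)) → Prop}
    [DecidablePred q] (hq : ∀ a, q a ↔ a.1 = i ∧ (a.2 : ℕ) = j)
    (f : (Σ i : Fin k, Fin (σ i)) → ℝ) : ∑ a, (if q a then f a else 0) = f ⟨i, j⟩ := by
  rw [Finset.sum_eq_single ⟨i, j⟩, if_pos ((hq _).2 ⟨rfl, rfl⟩)]
  · rintro ⟨i', j'⟩ - hne
    refine if_neg fun h => hne ?_
    obtain ⟨rfl, h⟩ := (hq _).1 h
    exact congrArg _ (Fin.ext h)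
  · exact fun h => absurd (Finset.mem_univ _) h

/-- The input equation kills `P` at the end of each chain, and the state equation `P_j = (N
P)_{j+1}` propagates this back to the start. -/
theorem integratorChains_fullRowRank : (integratorChains σ).FullRowRank := by
  intro r N P Q h₁ h₂
  have hs : ∀ z i j (hj : j + 1 < σ i), P z ⟨i, ⟨j, by omega⟩⟩ = (N * P) z ⟨i, ⟨j + 1, hj⟩⟩ := by
    intro z i j hj
    rw [← h₁]
    simp only [integratorChains, Matrix.add_apply, Matrix.mul_apply, of_apply, mul_ite, mul_one,
      mul_zero]
    rw [sum_chain_ite (σ := σ) (i := i) ⟨j, by omega⟩]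
    · simp
    · simp
  have h0 : ∀ z i (h : 0 < σ i), Q z i = (N * P) z ⟨i, ⟨0, h⟩⟩ := by
    intro z i h
    rw [← h₁]
    simp [integratorChains, Matrix.mul_apply]
  have hB : ∀ z i j (hj : j + 1 = σ i), P z ⟨i, ⟨j, by omega⟩⟩ = 0 := by
    intro z i j hj
    have := congrFun₂ h₂ z i
    simp only [integratorChains, Matrix.add_apply, Matrix.mul_apply, of_apply, mul_ite, mul_one,
      mul_zero] at this
    rw [sum_chain_ite (σ := σ) (i := i) ⟨j, by omega⟩] at this
    · simpa [show ∀ a, ¬ (a = i ∧ σ a = 0) by grind] using this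
    · rintro ⟨i', j'⟩
      grind
  have hD : ∀ z i, σ i = 0 → Q z i = 0 := by
    intro z i hi
    have := congrFun₂ h₂ z i
    simp only [integratorChains, Matrix.add_apply, Matrix.mul_apply, of_apply, mul_ite, mul_one,
      mul_zero] at this
    rw [Finset.sum_eq_zero, Finset.sum_eq_single i] at this
    · simpa [hi] using this
    · grind
    · simp
    · rintro ⟨i', j'⟩ -
      grind
  -- Here `l` is the distance to the end of the chain.
  have hP : ∀ l i j (hj : j < σ i), l + j + 1 = σ i → ∀ z, P z ⟨i, ⟨j, hj⟩⟩ = 0 := by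
    intro l
    induction l with
    | zero => exact fun i j hj hl z => hB z i j (by omega)
    | succ l ih =>
      intro i j hj hl z
      rw [hs z i j (by omega), Matrix.mul_apply]
      exact Finset.sum_eq_zero fun w _ => by rw [ih i (j + 1) (by omega) (by omega) w, mul_zero]
  have hP0 : P = 0 := by
    ext z ⟨i, j, hj⟩
    exact hP (σ i - j - 1) i j hj (by omega) z
  refine ⟨hP0, ?_⟩
  ext z i
  rcases Nat.eq_zero_or_pos (σ i) with h | h
  · exact hD z i h
  · rw [h0 z i h, hP0, Matrix.mul_zero]
    rfl

/-- The output equation kills `P` at the start of each chain, and `P_{j+1} = (P N)_j` propagates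
this forward. -/
theorem integratorChains_fullColRank : (integratorChains σ).FullColRank := by
  intro r N P Q h₁ h₂
  have hs : ∀ z i j (hj : j + 1 < σ i), P ⟨i, ⟨j + 1, hj⟩⟩ z = (P * N) ⟨i, ⟨j, by omega⟩⟩ z := by
    intro z i j hj
    rw [← h₁]
    simp only [integratorChains, Matrix.add_apply, Matrix.mul_apply, of_apply, ite_mul, one_mul,
      zero_mul]
    rw [sum_chain_ite (σ := σ) (i := i) ⟨j + 1, by omega⟩]
    · simp [show j + 1 ≠ σ i by omega]
    · grind
  have hB : ∀ z i j (hj : j + 1 = σ i), Q i z = (P * N) ⟨i, ⟨j, by omega⟩⟩ z := by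
    intro z i j hj
    rw [← h₁]
    simp only [integratorChains, Matrix.add_apply, Matrix.mul_apply, of_apply, ite_mul, one_mul,
      zero_mul]
    rw [Finset.sum_eq_zero]
    · simp [hj]
    · rintro ⟨i', j'⟩ -
      grind
  have h0 : ∀ z i (h : 0 < σ i), P ⟨i, ⟨0, h⟩⟩ z = 0 := by
    intro z i h
    have := congrFun₂ h₂ i z
    simp only [integratorChains, Matrix.add_apply, Matrix.mul_apply, of_apply, ite_mul, one_mul,
      zero_mul] at this
    rw [sum_chain_ite (σ := σ) (i := i) ⟨0, h⟩] at this
    · simpa [h.ne'] using this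
    · grind
  have hD : ∀ z i, σ i = 0 → Q i z = 0 := by
    intro z i hi
    have := congrFun₂ h₂ i z
    simp only [integratorChains, Matrix.add_apply, Matrix.mul_apply, of_apply, ite_mul, one_mul,
      zero_mul] at this
    rw [Finset.sum_eq_zero] at this
    · simpa [hi] using this
    · rintro ⟨i', j'⟩ -
      grind
  have hP : ∀ j i (hj : j < σ i), ∀ z, P ⟨i, ⟨j, hj⟩⟩ z = 0 := by
    intro j
    induction j with
    | zero => exact fun i hj z => h0 z i hj
    | succ j ih =>
      intro i hj z
      rw [hs z i j hj, Matrix.mul_apply]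
      exact Finset.sum_eq_zero fun w _ => by rw [ih i (by omega) w, zero_mul]
  have hP0 : P = 0 := by
    ext ⟨i, j, hj⟩ z
    exact hP j i hj z
  refine ⟨hP0, ?_⟩
  ext i z
  rcases Nat.eq_zero_or_pos (σ i) with h | h
  · exact hD z i h
  · rw [hB z i (σ i - 1) (by omega), hP0, Matrix.zero_mul]
    rfl

end Chains

namespace ControlSystem

variable {X W Y : Type} [Fintype X] [DecidableEq X] [Fintype W] [DecidableEq W]
  [Fintype Y] [DecidableEq Y] {S : ControlSystem X W Y}

theorem IsPrime.fullRowRank (h : S.IsPrime) : S.FullRowRank := by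
  obtain ⟨k, σ, eX, eW, eY, e⟩ := h
  exact (integratorChains_fullRowRank.reindex eX eW eY).of_morseEquivalent e

theorem IsPrime.fullColRank (h : S.IsPrime) : S.FullColRank := by
  obtain ⟨k, σ, eX, eW, eY, e⟩ := h
  exact (integratorChains_fullColRank.reindex eX eW eY).of_morseEquivalent e

end ControlSystem

/-! ### Block matrix algebra and the normal form -/

theorem fromRows_add_fromRows {m₁ m₂ n : Type} (A A' : Matrix m₁ n ℝ) (B B' : Matrix m₂ n ℝ) :
    fromRows A B + fromRows A' B' = fromRows (A + A') (B + B') := by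
  ext (i | i) j <;> rfl

theorem fromCols_add_fromCols {m n₁ n₂ : Type} (A A' : Matrix m n₁ ℝ) (B B' : Matrix m n₂ ℝ) :
    fromCols A B + fromCols A' B' = fromCols (A + A') (B + B') := by
  ext i (j | j) <;> rfl

theorem zero_fromCols_fromRows {m₁ m₂ n₁ n₂ : Type} (A : Matrix m₁ n₂ ℝ) (B : Matrix m₂ n₂ ℝ) :
    fromCols (0 : Matrix (m₁ ⊕ m₂) n₁ ℝ) (fromRows A B) = fromBlocks 0 A 0 B := by
  rw [← fromRows_zero, fromCols_fromRows_eq_fromBlocks]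

theorem add_submatrix {m n m' n' : Type} (A B : Matrix m n ℝ) (e : m' → m) (f : n' → n) :
    A.submatrix e f + B.submatrix e f = (A + B).submatrix e f :=
  rfl

/-- The transformation given by a state coordinate change `Tx`, feedbacks `Fu`, `Fv` and an output
injection `K` brings `L` into `L'`. -/
theorem brings_of_feedback_injection {X U V Y : Type} [Fintype X] [DecidableEq X] [Fintype U]
    [DecidableEq U] [Fintype V] [DecidableEq V] [Fintype Y] [DecidableEq Y]
    {L L' : ODECS X U V Y} (Tx : GL X ℝ) (Fu : Matrix U X ℝ) (Fv : Matrix V X ℝ)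
    (K : Matrix X Y ℝ)
    (hA : L'.A * Tx.val = Tx.val * (L.A + L.Bu * Fu + L.Bv * Fv + K * (L.C + L.Du * Fu)))
    (hBu : L'.Bu = Tx.val * (L.Bu + K * L.Du)) (hBv : L'.Bv = Tx.val * L.Bv)
    (hC : L'.C * Tx.val = L.C + L.Du * Fu) (hDu : L'.Du = L.Du) :
    (EMTransformation.mk Tx 1 1 1 Fu Fv 0 K).Brings L L' := by
  have hx : Tx.val * (Tx⁻¹).val = 1 := Tx.mul_inv
  have hA' : L'.A = Tx.val * (L.A + L.Bu * Fu + L.Bv * Fv + K * (L.C + L.Du * Fu)) *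
      (Tx⁻¹).val := by
    rw [← hA, Matrix.mul_assoc, hx, Matrix.mul_one]
  have hC' : L'.C = (L.C + L.Du * Fu) * (Tx⁻¹).val := by
    rw [← hC, Matrix.mul_assoc, hx, Matrix.mul_one]
  simp only [EMTransformation.Brings, ODECS.systemMatrix, fromBlocks_multiply, hA', hBu, hBv, hC',
    hDu, inv_one, Units.val_one, Matrix.zero_mul, add_zero, Matrix.mul_zero, zero_add,
    Matrix.one_mul, mul_fromCols, fromCols_add_fromCols, fromCols_mul_fromRows, fromBlocks_one,
    Matrix.mul_one]
  congr 1
  · simp only [Matrix.add_mul, Matrix.mul_add, Matrix.mul_assoc]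
    abel
  · simp only [Matrix.mul_add, Matrix.mul_assoc]
  · simp only [Matrix.add_mul, Matrix.mul_assoc]

theorem theorem3 (d : BlockSizes) (L : ODECS (Fin d.n) (Fin d.m) (Fin d.s) (Fin d.p))
    (hL : IsEMTF d L) :
    ∃ (T : EMTransformation (Fin d.n) (Fin d.m) (Fin d.s) (Fin d.p))
      (L' : ODECS (Fin d.n) (Fin d.m) (Fin d.s) (Fin d.p)),
      T.Brings L L' ∧ IsEMNF d L' := by
  obtain ⟨A₁, A₁₂, A₁₃, A₁₄, A₂, A₂₄, A₃, A₃₄, A₄, Bu₁, Bu₁₂, Bu₃, Bv₁, Bv₁₂, Bv₃, C₃, C₃₄, C₄,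
    Du₃, rfl, hd⟩ := hL
  -- `id` keeps `hd` available: the unchanged diagonal blocks reuse it at the end.
  obtain ⟨hctrl, hobs, hprime⟩ := id hd
  obtain ⟨X₁₂, F₁₂, h₁₂, -⟩ := hctrl.fullRowRank.exists_solution A₂ A₁₂ 0
  -- The second right-hand side makes the same `X₁₃`, `K₁₃` cancel `Bu₁₂` and `Bv₁₂`.
  obtain ⟨X₁₃, K₁₃, h₁₃, hB⟩ := hprime.fullColRank.exists_solution A₁ A₁₃ (-fromCols Bu₁₂ Bv₁₂)
  obtain ⟨X₂₄, K₂₄, h₂₄, -⟩ := hobs.fullColRank.exists_solution A₂ A₂₄ 0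
  obtain ⟨X₃₄, F₃₄, h₃₄, hC⟩ := hprime.fullRowRank.exists_solution A₄ A₃₄ C₃₄
  obtain ⟨Fu₁₂, Fv₁₂, rfl⟩ : ∃ Fu Fv, F₁₂ = fromRows Fu Fv := ⟨_, _, (fromRows_toRows _).symm⟩
  obtain ⟨Fu₃₄, Fv₃₄, rfl⟩ : ∃ Fu Fv, F₃₄ = fromRows Fu Fv := ⟨_, _, (fromRows_toRows _).symm⟩
  -- Solved last: the right-hand side collects what the other choices add to the (1,4) block.
  obtain ⟨X₁₄, F₁₄, h₁₄, -⟩ := hctrl.fullRowRank.exists_solution A₄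
    (A₁₄ + Bu₁₂ * Fu₃₄ + Bv₁₂ * Fv₃₄ + K₁₃ * (C₃₄ + Du₃ * Fu₃₄) + X₁₂ * (A₂₄ + K₂₄ * C₄) +
      X₁₃ * (A₃₄ + Bu₃ * Fu₃₄ + Bv₃ * Fv₃₄)) 0
  obtain ⟨Fu₁₄, Fv₁₄, rfl⟩ : ∃ Fu Fv, F₁₄ = fromRows Fu Fv := ⟨_, _, (fromRows_toRows _).symm⟩
  simp only [fromCols_mul_fromRows, mul_fromCols, fromCols_add_fromCols, Matrix.zero_mul,
    Matrix.mul_zero, add_zero, fromCols_neg, fromCols_ext_iff] at h₁₂ h₁₃ hB h₂₄ h₃₄ hC h₁₄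
  let T : Matrix ((Fin d.n₁ ⊕ Fin d.n₂) ⊕ (Fin d.n₃ ⊕ Fin d.n₄))
      ((Fin d.n₁ ⊕ Fin d.n₂) ⊕ (Fin d.n₃ ⊕ Fin d.n₄)) ℝ :=
    fromBlocks (fromBlocks 1 X₁₂ 0 1) (fromBlocks X₁₃ X₁₄ 0 X₂₄) 0 (fromBlocks 1 X₃₄ 0 1)
  let Fu : Matrix (Fin d.m₁ ⊕ Fin d.m₃) ((Fin d.n₁ ⊕ Fin d.n₂) ⊕ (Fin d.n₃ ⊕ Fin d.n₄)) ℝ :=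
    fromCols (fromBlocks 0 Fu₁₂ 0 0) (fromBlocks 0 Fu₁₄ 0 Fu₃₄)
  let Fv : Matrix (Fin d.s₁ ⊕ Fin d.s₃) ((Fin d.n₁ ⊕ Fin d.n₂) ⊕ (Fin d.n₃ ⊕ Fin d.n₄)) ℝ :=
    fromCols (fromBlocks 0 Fv₁₂ 0 0) (fromBlocks 0 Fv₁₄ 0 Fv₃₄)
  let K : Matrix ((Fin d.n₁ ⊕ Fin d.n₂) ⊕ (Fin d.n₃ ⊕ Fin d.n₄)) (Fin d.p₃ ⊕ Fin d.p₄) ℝ :=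
    fromRows (fromBlocks K₁₃ 0 0 K₂₄) 0
  obtain ⟨Tx, hTx⟩ : IsUnit (reindex d.stateEquiv d.stateEquiv T) :=
    (isUnit_iff_isUnit_det _).2 (by simp [T, det_fromBlocks_zero₂₁])
  refine ⟨_, blockTriangularSystem d A₁ 0 0 0 A₂ 0 A₃ 0 A₄ Bu₁ 0 Bu₃ Bv₁ 0 Bv₃ C₃ 0 C₄ Du₃,
    brings_of_feedback_injection Tx (reindex finSumFinEquiv d.stateEquiv Fu)
      (reindex finSumFinEquiv d.stateEquiv Fv) (reindex d.stateEquiv finSumFinEquiv K)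
      ?_ ?_ ?_ ?_ rfl, _, _, _, _, _, _, _, _, _, _, _, rfl, hd⟩ <;>
    simp only [blockTriangularSystem, hTx, reindex_apply, submatrix_mul_equiv, add_submatrix] <;>
    congr 1 <;>
    simp only [T, Fu, Fv, K, fromBlocks_multiply, fromRows_mul, mul_fromCols,
      fromBlocks_add, fromCols_add_fromCols, fromRows_add_fromRows, fromCols_mul_fromBlocks,
      fromBlocks_mul_fromRows, Matrix.zero_mul, Matrix.mul_zero, add_zero, zero_add,
      Matrix.one_mul, Matrix.mul_one, fromBlocks_zero,
      fromCols_fromRows_eq_fromBlocks, zero_fromCols_fromRows,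
      fromBlocks_inj, fromRows_ext_iff, fromCols_ext_iff, true_and, and_true]
  -- The remaining state blocks are (1,2), (1,3), (1,4), (2,4), (3,4).
  · rw [sub_eq_iff_eq_add, sub_eq_iff_eq_add] at h₁₂ h₁₃ h₁₄ h₂₄ h₃₄
    refine ⟨?_, ⟨?_, ?_, ?_⟩, ?_⟩
    · rw [h₁₂]
      abel
    · rw [h₁₃]
    · rw [h₁₄]
      abel
    · rw [h₂₄]
    · rw [h₃₄]
      abel
  · rw [add_assoc, add_comm (K₁₃ * Du₃), hB.1, add_neg_cancel]
  · rw [hB.2, add_neg_cancel]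
  · rw [← hC, sub_add_cancel]
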